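/- Let $V$ be a finite set. Consider integer-weighted graphs on $V$, directed or undirected (loops are possible edges), given by a weight function $c_G$ that assigns a non-negative integer to every possible edge; the edges of $G$ are the possible edges of positive weight, and in the undirected case $uv=vu$. The out- and in-strength of $u$ in a directed graph are $\sum_v c_G(uv)$ and $\sum_v c_G(vu)$; the strength of $u$ in an undirected graph is the sum of the weights of the edges at $u$, a loop being counted twice. Fix a graph $G_0$ and a set $\mathcal F$ of possible edges, and let $\mathcal G$ be the (finite) set of all graphs $G$ on $V$ with the same strength sequence (in the directed case: the same in- and out-strengths) as $G_0$ and with $c_G(uv)=c_{G_0}(uv)$ for all $uv\in\mathcal F$. Put $$N_G(u)=\{v: vu\in E(G),\ vu\notin\mathcal F\},\qquad M_G(u)=\{v: uv\notin\mathcal F\}.$$ *Sampling a vertex sequence at $G$.* Draw $W_0$ uniformly from $\{v: N_G(v)\ne\emptyset\}$. For $n=0,2,4,\dots$: draw $W_{n+1}$ uniformly from $N_G(W_n)\setminus\{W_{n-1}\}$ (from $N_G(W_0)$ if $n=0$); if $W_0\in M_G(W_{n+1})\setminus\{W_n\}$, stop with the sequence $W=W_0W_1\cdots W_{n+1}W_0$;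 otherwise draw $W_{n+2}$ uniformly from $M_G(W_{n+1})\setminus\{W_n\}$ and continue. If a set to draw from is empty, or if the procedure never stops, no sequence is obtained. For a sequence $w=w_0w_1\cdots w_kw_0$ let $z=\{w,w^r\}$, where $w^r$ is the reverse of $w$, let $\mathbb V_G(z)$ be the probability that the sequence obtained at $G$ is in $z$, and let $n_w(uv)$ be the number of occurrences of $uv$ among $w_1w_0,w_3w_2,\dots,w_kw_{k-1}$ minus the number of occurrences among $w_1w_2,w_3w_4,\dots,w_kw_0$. *One iteration of the Weighted Graph Sampler at $G$.* Sample a vertex sequence. If none is obtained, stay at $G$. If $w$ is obtained, let $G_\Delta$ be the graph with weights $c_G(uv)+n_w(uv)\Delta$, draw an integer $\Delta$ from those for which all these weights are non-negative, with probability proportional to $\mathbb V_{G_\Delta}(z)$, and move to $G_\Delta$ (if $n_w=0$, then $G_\Delta=G$ for all $\Delta$, and the chain stays at $G$). **Proposition.** Started in $\mathcal G$, the Markov chain whose steps are iterations of the Weighted Graph Sampler stays in $\mathcal G$; it is reversible and ergodic with respect to the uniform distribution on $\mathcal G$. That is, the uniform distribution satisfies detailed balance and is stationary, the chain is irreducible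 and aperiodic on $\mathcal G$, and from every initial graph in $\mathcal G$ its law converges in total variation to the uniform distribution on $\mathcal G$. -/

import Mathlib

open scoped ENNReal Topology

namespace WGS

noncomputable section

/-! ## Ergodicity of a Markov chain with countable state space -/

section MarkovChain

variable {X : Type*}

/-- The law after `n` steps of the chain with transition probabilities `P`, started at `x`. -/
def nStep (P : X → PMF X) : ℕ → X → PMF X
  | 0, x => PMF.pure x
  | n + 1, x => (nStep P n x).bind P

/-- Detailed balance. -/
def IsReversible (P : X → PMF X) (π : PMF X) : Prop :=
  ∀ x y, π x * P x y = π y * P y x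

/-- The chain with transition probabilities `P`, run on the set of states `S`, is ergodic with
respect to `π`: the chain stays in `S`, `π` is a stationary distribution carried by `S`, the chain
is irreducible and aperiodic on `S`, and from every starting state in `S` the law of the chain
converges to `π` in total variation. -/
structure IsErgodicOn (P : X → PMF X) (S : Set X) (π : PMF X) : Prop where
  stays : ∀ x ∈ S, (P x).support ⊆ S
  carried : π.support ⊆ S
  stationary : π.bind P = π
  irreducible : ∀ x ∈ S, ∀ y ∈ S, ∃ n, nStep P n x y ≠ 0
  aperiodic : ∀ x ∈ S, ∀ d : ℕ, (∀ n, 1 ≤ n → nStep P n x x ≠ 0 → d ∣ n) → d = 1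
  tendsto : ∀ x ∈ S, Filter.Tendsto
    (fun n => ∑' y, |(nStep P n x y).toReal - (π y).toReal|) Filter.atTop (𝓝 0)

end MarkovChain

/-! ## The sampler

`V` is the vertex set and `E` the set of possible edges, `e u v : E` being the possible edge `uv`.
For directed graphs `E = V × V` and `e u v = (u, v)`; for undirected graphs `E = Sym2 V` and
`e u v = s(u, v)`. An integer-weighted graph is given by its weight function `G : E → ℕ`; its edges
are the possible edges of positive weight. `F` is the set of fixed possible edges. -/

section Sampler

variable {V E : Type*} [Fintype V] (e : V → V → E) (F : Set E)

open Classical in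
/-- `N_G(u)`: the vertices `v` for which `vu` is an edge of `G` that is not fixed. -/
def nbrN (G : E → ℕ) (u : V) : Finset V :=
  Finset.univ.filter fun v => 0 < G (e v u) ∧ e v u ∉ F

open Classical in
/-- `M_G(u)`: the vertices `v` for which `uv` is not fixed. -/
def nbrM (u : V) : Finset V :=
  Finset.univ.filter fun v => e u v ∉ F

/-- States of the loop that samples the vertex sequence. -/
inductive WalkState (V : Type*) where
  /-- The loop is running; the arguments are `W₀`, `Wₙ₋₁` (`none` if `n = 0`), `Wₙ` and the list
  `[W₀, …, Wₙ]`. -/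
  | running (w₀ : V) (prev : Option V) (cur : V) (path : List V)
  /-- The loop has ended with the sequence `w = [W₀, …, Wₙ₊₁, W₀]`. -/
  | closed (w : List V)
  /-- A set to sample from was empty. -/
  | stuck

open Classical in
/-- Sampling of `W₀`, uniformly from the vertices `v` with `N_G(v) ≠ ∅`. -/
def walkStart (G : E → ℕ) : PMF (WalkState V) :=
  if h : (Finset.univ.filter fun v : V => (nbrN e F G v).Nonempty).Nonempty then
    (PMF.uniformOfFinset _ h).map fun v => .running v none v [v]
  else PMF.pure .stuck

open Classical in
/-- One pass through the loop: `Wₙ₊₁` is uniform on `N_G(Wₙ) \ {Wₙ₋₁}`; then `Wₙ₊₂ = W₀` if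
`W₀ ∈ M_G(Wₙ₊₁) \ {Wₙ}`, and otherwise `Wₙ₊₂` is uniform on `M_G(Wₙ₊₁) \ {Wₙ}`. -/
def walkStep (G : E → ℕ) : WalkState V → PMF (WalkState V)
  | .running w₀ prev cur path =>
    if hA : ((nbrN e F G cur).filter fun v => prev ≠ some v).Nonempty then
      (PMF.uniformOfFinset _ hA).bind fun x =>
        if w₀ ∈ (nbrM e F x).erase cur then PMF.pure (.closed (path ++ [x, w₀]))
        else if hB : ((nbrM e F x).erase cur).Nonempty then
          (PMF.uniformOfFinset _ hB).map fun y => .running w₀ (some x) y (path ++ [x, y])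
        else PMF.pure .stuck
    else PMF.pure .stuck
  | .closed w => PMF.pure (.closed w)
  | .stuck => PMF.pure .stuck

/-- The law of the state of the loop after `n` passes. -/
def walk (G : E → ℕ) : ℕ → PMF (WalkState V)
  | 0 => walkStart e F G
  | n + 1 => (walk G n).bind (walkStep e F G)

/-- The probability that the loop ends with the sequence `w` (the probabilities that it has done so
within `n` passes increase with `n`). -/
def seqProb (G : E → ℕ) (w : List V) : ℝ≥0∞ := ⨆ n, walk e F G n (.closed w)

theorem walk_closed_mono (G : E → ℕ) (w : List V) :
    Monotone fun n => walk e F G n (.closed w) := by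
  refine monotone_nat_of_le_succ fun n => ?_
  show _ ≤ ((walk e F G n).bind (walkStep e F G)) (.closed w)
  rw [PMF.bind_apply]
  refine le_trans ?_ (ENNReal.le_tsum (WalkState.closed w))
  simp [walkStep]

theorem tsum_seqProb_le_one (G : E → ℕ) : ∑' w, seqProb e F G w ≤ 1 := by
  rw [ENNReal.tsum_eq_iSup_sum]
  refine iSup_le fun s => ?_
  unfold seqProb
  rw [ENNReal.finsetSum_iSup_of_monotone fun w => walk_closed_mono e F G w]
  refine iSup_le fun n => ?_
  calc ∑ w ∈ s, walk e F G n (.closed w)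
      ≤ ∑' w, walk e F G n (.closed w) := ENNReal.sum_le_tsum s
    _ ≤ ∑' t, walk e F G n t :=
        ENNReal.tsum_comp_le_tsum_of_injective (fun a b h => by simpa using h) _
    _ = 1 := (walk e F G n).tsum_coe

theorem hasSum_elim {α : Type*} (p : α → ℝ≥0∞) (h : ∑' a, p a ≤ 1) :
    HasSum (fun o : Option α => o.elim (1 - ∑' a, p a) p) 1 := by
  rw [ENNReal.summable.hasSum_iff, ENNReal.tsum_eq_add_tsum_ite none,
    ← Function.Injective.tsum_eq (Option.some_injective α)]
  · simpa using tsub_add_cancel_of_le h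
  · rintro (_ | a) ha
    · simp at ha
    · exact ⟨a, rfl⟩

/-- The law of the sampled vertex sequence. The value `none` collects the runs that yield no
sequence: those that return the identity kernel because a set to sample from is empty, and those
in which the loop never ends. -/
def seqLaw (G : E → ℕ) : PMF (Option (List V)) :=
  ⟨fun o => o.elim (1 - ∑' w, seqProb e F G w) (seqProb e F G),
    hasSum_elim _ (tsum_seqProb_le_one e F G)⟩

open Classical in
/-- `𝕍_G(z)` for the class `z = {w, wʳ}` of a vertex sequence `w` and its reverse. -/
def classProb (G : E → ℕ) (w : List V) : ℝ≥0∞ :=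
  ∑ w' ∈ ({w, w.reverse} : Finset (List V)), seqProb e F G w'

open Classical in
/-- `n_w(x)` for `w = [w₀, w₁, …, w_k, w₀]`: the number of occurrences of `x` among `w₁w₀`, `w₃w₂`,
…, `w_kw_{k-1}` minus the number of occurrences among `w₁w₂`, `w₃w₄`, …, `w_kw₀`. -/
def visits : List V → E → ℤ
  | a :: b :: c :: l, x =>
    (if e b a = x then 1 else 0) - (if e b c = x then 1 else 0) + visits (c :: l) x
  | _, _ => 0

/-- The admissible values of `Δ`: no weight becomes negative. -/
def Admissible (G : E → ℕ) (w : List V) (Δ : ℤ) : Prop :=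
  ∀ x, 0 ≤ (G x : ℤ) + visits e w x * Δ

/-- The graph `G_Δ` with weights `c_G(x) + n_w(x) Δ`. -/
def shift (G : E → ℕ) (w : List V) (Δ : ℤ) : E → ℕ :=
  fun x => ((G x : ℤ) + visits e w x * Δ).toNat

open Classical in
/-- The weight `𝕍_{G_Δ}(z)` of an admissible `Δ`, where `z` is the class of `w`. -/
def deltaWeight (G : E → ℕ) (w : List V) (Δ : ℤ) : ℝ≥0∞ :=
  if Admissible e G w Δ then classProb e F (shift e G w Δ) w else 0

open Classical in
/-- The law of `Δ`: proportional to `𝕍_{G_Δ}(z)` on the admissible range. For a sequence `w` that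
can be sampled at `G`, the weights have an infinite sum only if `n_w = 0`; every `Δ` then gives the
graph `G`, and `Δ = 0` is taken. -/
def deltaLaw (G : E → ℕ) (w : List V) : PMF ℤ :=
  if h : ∑' Δ, deltaWeight e F G w Δ ≠ 0 ∧ ∑' Δ, deltaWeight e F G w Δ ≠ ∞ then
    PMF.normalize (deltaWeight e F G w) h.1 h.2
  else PMF.pure 0

/-- One iteration of the weighted graph sampler. -/
def sampler (G : E → ℕ) : PMF (E → ℕ) :=
  (seqLaw e F G).bind fun o =>
    match o with
    | none => PMF.pure G
    | some w => (deltaLaw e F G w).map (shift e G w)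

end Sampler

/-! ## The state spaces -/

section StateSpaces

variable {V : Type*} [Fintype V]

/-- Out-strength of a vertex of a directed graph. -/
def outStrength (G : V × V → ℕ) (u : V) : ℕ := ∑ v, G (u, v)

/-- In-strength of a vertex of a directed graph. -/
def inStrength (G : V × V → ℕ) (u : V) : ℕ := ∑ v, G (v, u)

/-- Strength of a vertex of an undirected graph; a loop has both of its ends at its vertex, so that
its weight counts twice. -/
def strength (G : Sym2 V → ℕ) (u : V) : ℕ := (∑ v, G s(u, v)) + G s(u, u)

/-- The directed graphs with the strength sequences of `G₀` and the weights of `G₀` on `F`. -/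
def directedGraphs (G₀ : V × V → ℕ) (F : Set (V × V)) : Set (V × V → ℕ) :=
  {G | (∀ u, outStrength G u = outStrength G₀ u) ∧ (∀ u, inStrength G u = inStrength G₀ u) ∧
    ∀ x ∈ F, G x = G₀ x}

/-- The undirected graphs with the strength sequence of `G₀` and the weights of `G₀` on `F`. -/
def undirectedGraphs (G₀ : Sym2 V → ℕ) (F : Set (Sym2 V)) : Set (Sym2 V → ℕ) :=
  {G | (∀ u, strength G u = strength G₀ u) ∧ ∀ x ∈ F, G x = G₀ x}

theorem finite_directedGraphs (G₀ : V × V → ℕ) (F : Set (V × V)) :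
    (directedGraphs G₀ F).Finite := by
  refine (Set.Finite.pi' (t := fun x : V × V => Set.Iic (outStrength G₀ x.1))
    fun x => Set.finite_Iic _).subset ?_
  rintro G ⟨h, -, -⟩ ⟨u, v⟩
  rw [Set.mem_Iic, ← h u]
  exact Finset.single_le_sum (f := fun v => G (u, v)) (fun _ _ => Nat.zero_le _)
    (Finset.mem_univ v)

theorem finite_undirectedGraphs (G₀ : Sym2 V → ℕ) (F : Set (Sym2 V)) :
    (undirectedGraphs G₀ F).Finite := by
  refine (Set.Finite.pi' (t := fun _ : Sym2 V => Set.Iic (∑ u, strength G₀ u))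
    fun x => Set.finite_Iic _).subset ?_
  rintro G ⟨h, -⟩ x
  induction x using Sym2.ind with
  | _ u v =>
    rw [Set.mem_Iic]
    calc G s(u, v) ≤ ∑ v, G s(u, v) :=
          Finset.single_le_sum (f := fun v => G s(u, v)) (fun _ _ => Nat.zero_le _)
            (Finset.mem_univ v)
      _ ≤ strength G u := Nat.le_add_right _ _
      _ = strength G₀ u := h u
      _ ≤ ∑ u, strength G₀ u :=
          Finset.single_le_sum (f := fun u => strength G₀ u) (fun _ _ => Nat.zero_le _)
            (Finset.mem_univ u)

/-- The uniform distribution on `directedGraphs G₀ F`. -/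
def directedUniform (G₀ : V × V → ℕ) (F : Set (V × V)) : PMF (V × V → ℕ) :=
  PMF.uniformOfFinset (finite_directedGraphs G₀ F).toFinset
    ⟨G₀, by simp [directedGraphs]⟩

/-- The uniform distribution on `undirectedGraphs G₀ F`. -/
def undirectedUniform (G₀ : Sym2 V → ℕ) (F : Set (Sym2 V)) : PMF (Sym2 V → ℕ) :=
  PMF.uniformOfFinset (finite_undirectedGraphs G₀ F).toFinset
    ⟨G₀, by simp [undirectedGraphs]⟩

end StateSpaces

end

end WGS

/-!
The probability `𝕍_G(z)` does not distinguish a vertex sequence from its reverse, and a move along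
the reverse with `-Δ` is the move along `w` with `Δ`. As `w` can be traversed from `G` to `G_Δ` and
back, and the normalizing constant of the law of `Δ` is the same for all graphs on the line
`G + ℤ n_w`, the probability of moving from `G` to `G'` is `∑_z 𝕍_G(z) 𝕍_{G'}(z) / C_z`, which is
symmetric; so the uniform distribution satisfies detailed balance. The value `Δ = 0` always has
positive probability, which gives aperiodicity.

For irreducibility, let `G ≠ H` have the same strengths. Started at an edge where `G` exceeds `H`,
the loop can alternately remove edges where `G` exceeds `H` and add edges where `H` exceeds `G`,
because a vertex where it cannot go on would have different strengths in `G` and `H`. Only the edge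
that closes the sequence is not a matter of choice, but at least two edges have then been removed
and one has been added, so `Δ = -1` brings `G` nearer to `H` in `ℓ¹`. The new graph contains all
added edges, so that the reverse sequence can be sampled there.
-/

namespace WGS

/-! ## Convergence of finite Markov chains -/

section Convergence

variable {X : Type*} {P : X → PMF X} {S : Finset X} {π : PMF X}

theorem nStep_one (P : X → PMF X) (x : X) : nStep P 1 x = P x := by
  simp [nStep, PMF.pure_bind]

theorem nStep_add (P : X → PMF X) (m n : ℕ) (x : X) :
    nStep P (m + n) x = (nStep P m x).bind (nStep P n) := by
  induction n with
  | zero => exact (PMF.bind_pure _).symm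
  | succ n ih =>
    change (nStep P (m + n) x).bind P = (nStep P m x).bind fun z => (nStep P n z).bind P
    rw [ih, PMF.bind_bind]

theorem nStep_add_ne_zero {m n : ℕ} {x y z : X} (hxy : nStep P m x y ≠ 0)
    (hyz : nStep P n y z ≠ 0) : nStep P (m + n) x z ≠ 0 := by
  rw [nStep_add, ← PMF.mem_support_iff, PMF.mem_support_bind_iff]
  exact ⟨y, hxy, hyz⟩

theorem nStep_ne_zero_of_le {m n : ℕ} (hmn : m ≤ n) {x y : X} (loop : P y y ≠ 0)
    (h : nStep P m x y ≠ 0) : nStep P n x y ≠ 0 := by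
  induction n, hmn using Nat.le_induction with
  | base => exact h
  | succ n _ ih => exact nStep_add_ne_zero ih (by rwa [nStep_one])

theorem support_nStep_subset {S : Set X} (stays : ∀ x ∈ S, (P x).support ⊆ S) (n : ℕ) {x : X}
    (hx : x ∈ S) : (nStep P n x).support ⊆ S := by
  induction n with
  | zero => simpa [nStep] using hx
  | succ n ih =>
    intro y hy
    obtain ⟨z, hz, hzy⟩ := (PMF.mem_support_bind_iff _ _ _).1 hy
    exact stays z (ih hz) hzy

theorem bind_nStep (stationary : π.bind P = π) (n : ℕ) : π.bind (nStep P n) = π := by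
  induction n with
  | zero => exact PMF.bind_pure _
  | succ n ih =>
    change π.bind (fun x => (nStep P n x).bind P) = π
    rw [← PMF.bind_bind, ih, stationary]

theorem apply_eq_zero_of_support_subset {p : PMF X} {S : Set X} (hp : p.support ⊆ S) {x : X}
    (hx : x ∉ S) : p x = 0 :=
  (p.apply_eq_zero_iff x).2 fun h => hx (hp h)

theorem sum_toReal_eq_one {p : PMF X} (hp : p.support ⊆ S) : ∑ x ∈ S, (p x).toReal = 1 := by
  rw [← ENNReal.toReal_sum fun x _ => p.apply_ne_top x, ← ENNReal.toReal_one, ← p.tsum_coe,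
    tsum_eq_sum fun x hx => apply_eq_zero_of_support_subset hp hx]

theorem toReal_bind_apply {p : PMF X} (hp : p.support ⊆ S) (Q : X → PMF X) (y : X) :
    (p.bind Q y).toReal = ∑ x ∈ S, (p x).toReal * (Q x y).toReal := by
  rw [PMF.bind_apply, tsum_eq_sum (s := S) fun x hx => ?_, ENNReal.toReal_sum fun x _ => ?_]
  · simp only [ENNReal.toReal_mul]
  · exact ENNReal.mul_ne_top (p.apply_ne_top x) ((Q x).apply_ne_top y)
  · rw [apply_eq_zero_of_support_subset hp hx, zero_mul]

/-- The `ℓ¹` distance on `S` of two probability mass functions, twice their total variation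
distance if `S` carries both. -/
noncomputable def l1Dist (S : Finset X) (p q : PMF X) : ℝ :=
  ∑ x ∈ S, |(p x).toReal - (q x).toReal|

theorem l1Dist_nonneg (S : Finset X) (p q : PMF X) : 0 ≤ l1Dist S p q :=
  Finset.sum_nonneg fun _ _ => abs_nonneg _

theorem tsum_abs_sub_eq_l1Dist {p q : PMF X} (hp : p.support ⊆ S) (hq : q.support ⊆ S) :
    ∑' x, |(p x).toReal - (q x).toReal| = l1Dist S p q :=
  tsum_eq_sum fun x hx => by
    simp [apply_eq_zero_of_support_subset hp hx, apply_eq_zero_of_support_subset hq hx]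

theorem l1Dist_bind_le {Q : X → PMF X} (hQ : ∀ x ∈ S, (Q x).support ⊆ S) {ε : ℝ}
    (hε : 0 ≤ ε) (hQε : ∀ x ∈ S, ∀ y ∈ S, ε ≤ (Q x y).toReal) {p q : PMF X}
    (hp : p.support ⊆ S) (hq : q.support ⊆ S) :
    l1Dist S (p.bind Q) (q.bind Q) ≤ (1 - ε) * l1Dist S p q := by
  have hS : (1 : ℝ) ≤ S.card := by
    obtain ⟨x, hx⟩ := p.support_nonempty
    exact_mod_cast Finset.card_pos.2 ⟨x, hp hx⟩
  -- `p - q` has total mass `0`, so the constant `ε` may be subtracted from the kernel.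
  have bind_sub (y : X) : (p.bind Q y).toReal - (q.bind Q y).toReal =
      ∑ x ∈ S, ((p x).toReal - (q x).toReal) * ((Q x y).toReal - ε) := by
    simp only [toReal_bind_apply hp, toReal_bind_apply hq, sub_mul, mul_sub,
      Finset.sum_sub_distrib, ← Finset.sum_mul, sum_toReal_eq_one hp, sum_toReal_eq_one hq]
    ring
  calc l1Dist S (p.bind Q) (q.bind Q)
      ≤ ∑ y ∈ S, ∑ x ∈ S, |(p x).toReal - (q x).toReal| * ((Q x y).toReal - ε) := by
        refine Finset.sum_le_sum fun y hy => ?_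
        rw [bind_sub]
        refine (Finset.abs_sum_le_sum_abs _ _).trans_eq (Finset.sum_congr rfl fun x hx => ?_)
        rw [abs_mul, abs_of_nonneg (sub_nonneg.2 (hQε x hx y hy))]
    _ = (1 - S.card * ε) * l1Dist S p q := by
        rw [Finset.sum_comm, l1Dist, mul_comm, Finset.sum_mul]
        refine Finset.sum_congr rfl fun x hx => ?_
        rw [← Finset.mul_sum, Finset.sum_sub_distrib, sum_toReal_eq_one (hQ x hx),
          Finset.sum_const, nsmul_eq_mul]
    _ ≤ (1 - ε) * l1Dist S p q :=
        mul_le_mul_of_nonneg_right (by nlinarith) (l1Dist_nonneg S p q)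

theorem exists_nStep_uniformly_pos (loop : ∀ x ∈ S, P x x ≠ 0)
    (irreducible : ∀ x ∈ S, ∀ y ∈ S, ∃ n, nStep P n x y ≠ 0) :
    ∃ N, ∃ ε : ℝ, 0 < ε ∧ ∀ x ∈ S, ∀ y ∈ S, ε ≤ (nStep P N x y).toReal := by
  have eventually_ne_zero : ∀ᶠ N in Filter.atTop, ∀ x ∈ S, ∀ y ∈ S, nStep P N x y ≠ 0 := by
    simp only [Finset.eventually_all]
    intro x hx y hy
    obtain ⟨n, hn⟩ := irreducible x hx y hy
    filter_upwards [Filter.eventually_ge_atTop n] with N hN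
    exact nStep_ne_zero_of_le hN (loop y hy) hn
  obtain ⟨N, hN⟩ := eventually_ne_zero.exists
  have eventually_le : ∀ᶠ ε in 𝓝[>] (0 : ℝ), ∀ x ∈ S, ∀ y ∈ S, ε ≤ (nStep P N x y).toReal := by
    simp only [Finset.eventually_all]
    exact fun x hx y hy => Filter.Eventually.filter_mono nhdsWithin_le_nhds <|
      eventually_le_nhds (ENNReal.toReal_pos (hN x hx y hy) (PMF.apply_ne_top _ _))
  obtain ⟨ε, hle, hε⟩ := (eventually_le.and self_mem_nhdsWithin).exists
  exact ⟨N, ε, hε, hle⟩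

theorem tendsto_zero_of_antitone_of_add_le_mul {f : ℕ → ℝ} (hanti : Antitone f)
    (hnonneg : ∀ n, 0 ≤ f n) {N : ℕ} {c : ℝ} (hc : c < 1) (hf : ∀ n, f (n + N) ≤ c * f n) :
    Filter.Tendsto f Filter.atTop (𝓝 0) := by
  have hlim := tendsto_atTop_ciInf hanti ⟨0, Set.forall_mem_range.2 hnonneg⟩
  have hle : ⨅ n, f n ≤ c * ⨅ n, f n :=
    le_of_tendsto_of_tendsto' ((Filter.tendsto_add_atTop_iff_nat N).2 hlim) (hlim.const_mul c) hf
  have hge : 0 ≤ ⨅ n, f n := le_ciInf hnonneg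
  have hzero : ⨅ n, f n = 0 := by nlinarith
  rwa [hzero] at hlim

theorem tendsto_l1Dist_nStep (stays : ∀ x ∈ S, (P x).support ⊆ S) (carried : π.support ⊆ S)
    (stationary : π.bind P = π) (loop : ∀ x ∈ S, P x x ≠ 0)
    (irreducible : ∀ x ∈ S, ∀ y ∈ S, ∃ n, nStep P n x y ≠ 0) {x : X} (hx : x ∈ S) :
    Filter.Tendsto (fun n => l1Dist S (nStep P n x) π) Filter.atTop (𝓝 0) := by
  have contract (n N : ℕ) {ε : ℝ} (hε : 0 ≤ ε)
      (h : ∀ x ∈ S, ∀ y ∈ S, ε ≤ (nStep P N x y).toReal) :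
      l1Dist S (nStep P (n + N) x) π ≤ (1 - ε) * l1Dist S (nStep P n x) π := by
    have := l1Dist_bind_le (fun z hz => support_nStep_subset stays N hz) hε h
      (support_nStep_subset stays n hx) carried
    rwa [bind_nStep stationary, ← nStep_add] at this
  have antitone : Antitone fun n => l1Dist S (nStep P n x) π := antitone_nat_of_succ_le fun n => by
    simpa using contract n 1 le_rfl fun _ _ _ _ => ENNReal.toReal_nonneg
  obtain ⟨N, ε, hε, hN⟩ := exists_nStep_uniformly_pos loop irreducible
  exact tendsto_zero_of_antitone_of_add_le_mul antitone (fun n => l1Dist_nonneg _ _ _)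
    (sub_lt_self 1 hε) fun n => contract n N hε.le hN

theorem isErgodicOn_of_loop (stays : ∀ x ∈ S, (P x).support ⊆ S) (carried : π.support ⊆ S)
    (stationary : π.bind P = π) (loop : ∀ x ∈ S, P x x ≠ 0)
    (irreducible : ∀ x ∈ S, ∀ y ∈ S, ∃ n, nStep P n x y ≠ 0) : IsErgodicOn P S π where
  stays := stays
  carried := carried
  stationary := stationary
  irreducible := irreducible
  aperiodic x hx d hd := Nat.dvd_one.1 (hd 1 le_rfl (by rw [nStep_one]; exact loop x hx))
  tendsto x hx := by
    simp only [tsum_abs_sub_eq_l1Dist (support_nStep_subset stays _ hx) carried]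
    exact tendsto_l1Dist_nStep stays carried stationary loop irreducible hx

theorem IsReversible.bind_eq (h : IsReversible P π) : π.bind P = π := by
  ext y
  rw [PMF.bind_apply, tsum_congr fun x => h x y, ENNReal.tsum_mul_left, (P y).tsum_coe, mul_one]

theorem isReversible_uniformOfFinset (hS : S.Nonempty) (stays : ∀ x ∈ S, (P x).support ⊆ S)
    (symm : ∀ x y, P x y = P y x) : IsReversible P (PMF.uniformOfFinset S hS) := by
  have leave_eq_zero {x y : X} (hx : x ∈ S) (hy : y ∉ S) : P x y = 0 :=
    apply_eq_zero_of_support_subset (stays x hx) hy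
  intro x y
  rw [symm x y, PMF.uniformOfFinset_apply, PMF.uniformOfFinset_apply]
  split_ifs with hx hy hy
  · rfl
  · rw [symm y x, leave_eq_zero hx hy, mul_zero, mul_zero]
  · rw [leave_eq_zero hy hx, mul_zero, mul_zero]
  · simp only [zero_mul]

end Convergence

/-! ## Alternating sequences -/

section Walk

variable {V E : Type*} (e : V → V → E) (F : Set E)

/-- `x ∈ N_G(cur) \ {prev}`: the walk at `cur` that came through `prev` may go on to `x`, along an
edge `x cur` whose weight the move is to lower. -/
def CanRemove (G : E → ℕ) (prev : Option V) (cur x : V) : Prop :=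
  (0 < G (e x cur) ∧ e x cur ∉ F) ∧ prev ≠ some x

/-- `y ∈ M_G(x) \ {cur}`: the walk at `x` that came through `cur` may go on to `y`, along a possible
edge `xy` whose weight the move is to raise. -/
def CanAdd (cur x y : V) : Prop :=
  y ≠ cur ∧ e x y ∉ F

/-- `Run e F G w₀ prev cur path`: the sampling loop can be running at `G` with first vertex `w₀`,
last two vertices `prev` and `cur`, and vertex list `path`. -/
inductive Run (G : E → ℕ) (w₀ : V) : Option V → V → List V → Prop
  | start {x : V} : CanRemove e F G none w₀ x → Run G w₀ none w₀ [w₀]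
  | step {prev : Option V} {cur x y : V} {path : List V} : Run G w₀ prev cur path →
      CanRemove e F G prev cur x → ¬CanAdd e F cur x w₀ → CanAdd e F cur x y →
      Run G w₀ (some x) y (path ++ [x, y])

/-- The vertex sequences that can be sampled at `G`. -/
inductive Closed (G : E → ℕ) : List V → Prop
  | close {w₀ : V} {prev : Option V} {cur x : V} {path : List V} : Run e F G w₀ prev cur path →
      CanRemove e F G prev cur x → CanAdd e F cur x w₀ → Closed G (path ++ [x, w₀])

/-- `Finish e F G w₀ prev cur l`: the sampling loop, running at `G` with first vertex `w₀` and last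
two vertices `prev` and `cur`, can end with a sequence that reads `l` from `cur` on. -/
inductive Finish (G : E → ℕ) (w₀ : V) : Option V → V → List V → Prop
  | close {prev : Option V} {cur x : V} : CanRemove e F G prev cur x → CanAdd e F cur x w₀ →
      Finish G w₀ prev cur [cur, x, w₀]
  | step {prev : Option V} {cur x y : V} {l : List V} : CanRemove e F G prev cur x →
      ¬CanAdd e F cur x w₀ → CanAdd e F cur x y → Finish G w₀ (some x) y l →
      Finish G w₀ prev cur (cur :: x :: l)

/-- `AltPath e F a c w`: the list `w = [a, …, c]` has odd length, and it runs only through possible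
edges that are not fixed. -/
inductive AltPath (a : V) : V → List V → Prop
  | singleton : AltPath a a [a]
  | step {cur x y : V} {path : List V} : AltPath a cur path → e x cur ∉ F → e x y ∉ F →
      AltPath a y (path ++ [x, y])

/-- The edges `w₁w₀, w₃w₂, …` of a vertex sequence of odd length, with multiplicities: those whose
weight is lowered when `Δ = -1`. Those whose weight is raised are `removed e w.reverse`. -/
def removed : List V → Multiset E
  | a :: b :: c :: l => e b a ::ₘ removed (c :: l)
  | _ => 0

variable {e F} {G G' : E → ℕ} {w₀ : V} {prev : Option V} {cur : V} {path w : List V}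

theorem Run.altPath (h : Run e F G w₀ prev cur path) : AltPath e F w₀ cur path := by
  induction h with
  | start => exact .singleton
  | step _ hx _ hy ih => exact ih.step hx.1.2 hy.2

theorem Closed.altPath (h : Closed e F G w) : ∃ w₀, AltPath e F w₀ w₀ w := by
  cases h with
  | close h hx hy => exact ⟨_, h.altPath.step hx.1.2 hy.2⟩

theorem AltPath.exists_eq_append {a c : V} (h : AltPath e F a c w) :
    ∃ l, w = l ++ [c] ∧ Even l.length := by
  induction h with
  | singleton => exact ⟨[], rfl, by simp⟩
  | @step cur x y _ _ _ _ ih =>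
    obtain ⟨l, rfl, hl⟩ := ih
    exact ⟨l ++ [cur, x], by simp, by simpa [Nat.even_add] using hl⟩

theorem AltPath.odd_length {a c : V} (h : AltPath e F a c w) : Odd w.length := by
  obtain ⟨l, rfl, hl⟩ := h.exists_eq_append
  simpa using hl.add_one

theorem removed_append (c : V) (m : List V) : ∀ l : List V, Even l.length →
    removed e (l ++ c :: m) = removed e (l ++ [c]) + removed e (c :: m)
  | [], _ => by simp [removed]
  | [a], h => by simp at h
  | [a, b], _ => by simp [removed]
  | a :: b :: d :: l, h => by
    have ih := removed_append c m (d :: l) (by simpa [Nat.even_add_one] using h)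
    simp only [List.cons_append, removed, Multiset.cons_add] at ih ⊢
    rw [ih]

theorem removed_reverse_cons (a b c : V) (l : List V) (hl : Even l.length) :
    removed e (a :: b :: c :: l).reverse = e b c ::ₘ removed e (c :: l).reverse := by
  have h := removed_append (e := e) c [b, a] l.reverse (by simpa using hl)
  simpa [removed, add_comm] using h

theorem card_removed_reverse : ∀ w : List V, Odd w.length →
    (removed e w.reverse).card = (removed e w).card
  | [], h => by simp at h
  | [a], _ => by simp
  | [a, b], h => by simp [Nat.odd_iff] at h
  | a :: b :: c :: l, h => by
    have hl : Even l.length := by simpa [parity_simps] using h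
    rw [removed_reverse_cons a b c l hl, removed, Multiset.card_cons, Multiset.card_cons,
      card_removed_reverse (c :: l) (by simpa using hl.add_one)]

theorem visits_eq [DecidableEq E] (z : E) : ∀ w : List V, Odd w.length →
    visits e w z = (removed e w).count z - (removed e w.reverse).count z
  | [], h => by simp at h
  | [a], _ => by simp [visits, removed]
  | [a, b], h => by simp [Nat.odd_iff] at h
  | a :: b :: c :: l, h => by
    have hl : Even l.length := by simpa [parity_simps] using h
    rw [removed_reverse_cons a b c l hl, removed, visits,
      visits_eq z (c :: l) (by simpa using hl.add_one), Multiset.count_cons, Multiset.count_cons]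
    simp only [eq_comm (a := z), Nat.cast_add, Nat.cast_ite, Nat.cast_one, Nat.cast_zero]
    split_ifs <;> ring

theorem visits_reverse (hw : Odd w.length) (z : E) : visits e w.reverse z = -visits e w z := by
  classical
  rw [visits_eq z _ (by simpa using hw), visits_eq z w hw, List.reverse_reverse, neg_sub]

theorem AltPath.removed_append {a c : V} (h : AltPath e F a c path) (x y : V) :
    removed e (path ++ [x, y]) = e x c ::ₘ removed e path := by
  obtain ⟨l, rfl, hl⟩ := h.exists_eq_append
  rw [List.append_assoc, List.singleton_append, WGS.removed_append c _ l hl, add_comm]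
  simp [removed]

theorem AltPath.removed_reverse_append {a c : V} (h : AltPath e F a c path) (x y : V) :
    removed e (path ++ [x, y]).reverse = e x y ::ₘ removed e path.reverse := by
  obtain ⟨l, rfl, -⟩ := h.exists_eq_append
  simp [removed]

theorem AltPath.visits_append [DecidableEq E] {a c : V} (h : AltPath e F a c path) {x y : V}
    (hxc : e x c ∉ F) (hxy : e x y ∉ F) :
    visits e (path ++ [x, y]) =
      visits e path + Pi.single (e x c) 1 - Pi.single (e x y) 1 := by
  ext z
  simp only [visits_eq z _ (h.step hxc hxy).odd_length, visits_eq z _ h.odd_length,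
    h.removed_append, h.removed_reverse_append, Multiset.count_cons, Pi.add_apply, Pi.sub_apply,
    Pi.single_apply]
  push_cast
  ring

theorem AltPath.visits_eq_zero {a c : V} (h : AltPath e F a c w) {z : E} (hz : z ∈ F) :
    visits e w z = 0 := by
  classical
  induction h with
  | singleton => rfl
  | step h hx hy ih =>
    rw [h.visits_append hx hy, Pi.sub_apply, Pi.add_apply, ih,
      Pi.single_eq_of_ne (ne_of_mem_of_not_mem hz hx),
      Pi.single_eq_of_ne (ne_of_mem_of_not_mem hz hy), add_zero, sub_zero]

theorem Finish.closed {p l : List V} (hl : Finish e F G w₀ prev cur l)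
    (h : Run e F G w₀ prev cur (p ++ [cur])) : Closed e F G (p ++ l) := by
  induction hl generalizing p with
  | close hx hy => simpa using Closed.close h hx hy
  | @step _ cur x y _ hx hw₀ hy _ ih =>
    have h' : Run e F G w₀ (some x) y ((p ++ [cur, x]) ++ [y]) := by
      simpa using h.step hx hw₀ hy
    simpa using ih h'

theorem Run.eq_singleton (h : Run e F G w₀ prev w₀ path) : path = [w₀] := by
  cases h with
  | start => rfl
  | step _ _ hw₀ hy => exact (hw₀ hy).elim

theorem Run.mem_removed_reverse {x : V} (h : Run e F G w₀ (some x) cur path) :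
    e x cur ∈ removed e path.reverse := by
  cases h with
  | step h =>
    rw [h.altPath.removed_reverse_append]
    exact Multiset.mem_cons_self _ _

theorem Run.removed_ne_zero (h : Run e F G w₀ prev cur path) (hcur : cur ≠ w₀) :
    removed e path ≠ 0 := by
  cases h with
  | start => exact (hcur rfl).elim
  | step h =>
    rw [h.altPath.removed_append]
    exact Multiset.cons_ne_zero

/-- Reversal exchanges removed and added edges, so that only the latter need to be edges of `G'`. -/
theorem Run.finish_reverse (h : Run e F G w₀ prev cur path)
    (hG' : ∀ z ∈ removed e path.reverse, 0 < G' z) (hcur : cur ≠ w₀) {x' : V}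
    (hx' : prev ≠ some x') : Finish e F G' w₀ (some x') cur path.reverse := by
  induction h generalizing x' with
  | start => exact (hcur rfl).elim
  | @step prev cur x y path h hx hw₀ hy ih =>
    rw [h.altPath.removed_reverse_append] at hG'
    have hyx : CanRemove e F G' (some x') y x :=
      ⟨⟨hG' _ (Multiset.mem_cons_self _ _), hy.2⟩, hx'.symm⟩
    have hycur : CanAdd e F y x cur := ⟨hy.1.symm, hx.1.2⟩
    rw [List.reverse_append]
    rcases eq_or_ne cur w₀ with rfl | hc
    · rw [h.eq_singleton]
      exact .close hyx hycur
    · exact .step hyx (fun h => hw₀ ⟨hc.symm, h.2⟩) hycur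
        (ih (fun z hz => hG' z (Multiset.mem_cons_of_mem hz)) hc hx.2)

theorem Closed.reverse (h : Closed e F G w) (hG' : ∀ z ∈ removed e w.reverse, 0 < G' z) :
    Closed e F G' w.reverse := by
  cases h with
  | @close w₀ prev cur x path h hx hw₀ =>
    rw [h.altPath.removed_reverse_append] at hG'
    have hfirst : CanRemove e F G' none w₀ x :=
      ⟨⟨hG' _ (Multiset.mem_cons_self _ _), hw₀.2⟩, nofun⟩
    have hfinish : Finish e F G' w₀ none w₀ (w₀ :: x :: path.reverse) :=
      .step hfirst (fun h => h.1 rfl) ⟨hw₀.1.symm, hx.1.2⟩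
        (h.finish_reverse (fun z hz => hG' z (Multiset.mem_cons_of_mem hz)) hw₀.1.symm hx.2)
    simpa using hfinish.closed (p := []) (.start hfirst)

theorem mem_support_uniformOfFinset_bind_iff {α β : Type*} {A : Finset α}
    [Decidable A.Nonempty] {f : α → PMF β} {b s : β} (hs : s ≠ b) :
    s ∈ (if hA : A.Nonempty then (PMF.uniformOfFinset A hA).bind f else PMF.pure b).support ↔
      ∃ x ∈ A, s ∈ (f x).support := by
  split_ifs with hA
  · simp only [PMF.mem_support_bind_iff, PMF.mem_support_uniformOfFinset_iff]
  · rw [Finset.not_nonempty_iff_eq_empty] at hA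
    simp [hA, hs]

variable [Fintype V]

theorem mem_support_walkStart_iff {s : WalkState V} (hs : s ≠ .stuck) :
    s ∈ (walkStart e F G).support ↔
      ∃ v, (∃ x, CanRemove e F G none v x) ∧ s = .running v none v [v] := by
  unfold walkStart PMF.map
  rw [mem_support_uniformOfFinset_bind_iff hs]
  simp only [Finset.mem_filter_univ]
  simp [Finset.Nonempty, nbrN, CanRemove]

theorem mem_support_walkStep_running_iff {s : WalkState V} (hs : s ≠ .stuck) :
    s ∈ (walkStep e F G (.running w₀ prev cur path)).support ↔
      ∃ x, CanRemove e F G prev cur x ∧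
        (CanAdd e F cur x w₀ ∧ s = .closed (path ++ [x, w₀]) ∨
          ¬CanAdd e F cur x w₀ ∧
            ∃ y, CanAdd e F cur x y ∧ s = .running w₀ (some x) y (path ++ [x, y])) := by
  classical
  have mem_add {x y : V} : y ∈ (nbrM e F x).erase cur ↔ CanAdd e F cur x y := by
    simp [nbrM, CanAdd]
  unfold walkStep PMF.map
  rw [mem_support_uniformOfFinset_bind_iff hs]
  refine exists_congr fun x => and_congr (by simp [nbrN, CanRemove]) ?_
  by_cases hclose : w₀ ∈ (nbrM e F x).erase cur
  · simp [hclose, mem_add.1 hclose]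
  · rw [if_neg hclose, mem_support_uniformOfFinset_bind_iff hs]
    simp [mem_add, mt mem_add.2 hclose]

theorem Run.of_mem_support_walk {n : ℕ}
    (h : .running w₀ prev cur path ∈ (walk e F G n).support) : Run e F G w₀ prev cur path := by
  induction n generalizing prev cur path with
  | zero =>
    obtain ⟨v, ⟨x, hx⟩, heq⟩ := (mem_support_walkStart_iff (by simp)).1 h
    cases heq
    exact .start hx
  | succ n ih =>
    obtain ⟨s, hs, h⟩ := (PMF.mem_support_bind_iff _ _ _).1 h
    cases s with
    | running =>
      obtain ⟨x, hx, ⟨-, heq⟩ | ⟨hw₀, y, hy, heq⟩⟩ :=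
        (mem_support_walkStep_running_iff (by simp)).1 h
      · cases heq
      · cases heq
        exact (ih hs).step hx hw₀ hy
    | closed => simp [walkStep] at h
    | stuck => simp [walkStep] at h

theorem Closed.of_mem_support_walk {n : ℕ} (h : .closed w ∈ (walk e F G n).support) :
    Closed e F G w := by
  induction n with
  | zero =>
    obtain ⟨v, -, heq⟩ := (mem_support_walkStart_iff (by simp)).1 h
    cases heq
  | succ n ih =>
    obtain ⟨s, hs, h⟩ := (PMF.mem_support_bind_iff _ _ _).1 h
    cases s with
    | running =>
      obtain ⟨x, hx, ⟨hw₀, heq⟩ | ⟨-, y, -, heq⟩⟩ :=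
        (mem_support_walkStep_running_iff (by simp)).1 h
      · cases heq
        exact .close (.of_mem_support_walk hs) hx hw₀
      · cases heq
    | closed w' =>
      obtain rfl : w = w' := by simpa [walkStep] using h
      exact ih hs
    | stuck => simp [walkStep] at h

theorem Run.exists_mem_support_walk (h : Run e F G w₀ prev cur path) :
    ∃ n, .running w₀ prev cur path ∈ (walk e F G n).support := by
  induction h with
  | @start x hx => exact ⟨0, (mem_support_walkStart_iff (by simp)).2 ⟨w₀, ⟨x, hx⟩, rfl⟩⟩
  | @step _ _ x y _ _ hx hw₀ hy ih =>
    obtain ⟨n, hn⟩ := ih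
    exact ⟨n + 1, (PMF.mem_support_bind_iff _ _ _).2 ⟨_, hn,
      (mem_support_walkStep_running_iff (by simp)).2 ⟨x, hx, .inr ⟨hw₀, y, hy, rfl⟩⟩⟩⟩

theorem Closed.exists_mem_support_walk (h : Closed e F G w) :
    ∃ n, .closed w ∈ (walk e F G n).support := by
  cases h with
  | @close _ _ _ x _ h hx hw₀ =>
    obtain ⟨n, hn⟩ := h.exists_mem_support_walk
    exact ⟨n + 1, (PMF.mem_support_bind_iff _ _ _).2 ⟨_, hn,
      (mem_support_walkStep_running_iff (by simp)).2 ⟨x, hx, .inl ⟨hw₀, rfl⟩⟩⟩⟩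

theorem seqProb_ne_zero_iff : seqProb e F G w ≠ 0 ↔ Closed e F G w := by
  have seqProb_ne_zero : seqProb e F G w ≠ 0 ↔ ∃ n, .closed w ∈ (walk e F G n).support := by
    simp [seqProb, PMF.mem_support_iff]
  rw [seqProb_ne_zero]
  exact ⟨fun ⟨_, h⟩ => .of_mem_support_walk h, Closed.exists_mem_support_walk⟩

end Walk

/-! ## Symmetry of the transition probabilities -/

section Symmetry

variable {V E : Type*} {e : V → V → E} {F : Set E} {G G' : E → ℕ} {w : List V} {Δ Δ' : ℤ}

/-- `G'` is the graph `G_Δ` on the line through `G` in the direction `n_w`; in contrast to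
`shift e G w Δ = G'`, this includes that `Δ` is admissible. -/
def IsShift (e : V → V → E) (w : List V) (Δ : ℤ) (G G' : E → ℕ) : Prop :=
  ∀ x, (G' x : ℤ) = G x + visits e w x * Δ

theorem isShift_iff : IsShift e w Δ G G' ↔ Admissible e G w Δ ∧ shift e G w Δ = G' := by
  constructor
  · refine fun h => ⟨fun x => by rw [← h]; positivity, funext fun x => ?_⟩
    rw [shift, ← h, Int.toNat_natCast]
  · rintro ⟨h, rfl⟩ x
    exact Int.toNat_of_nonneg (h x)

theorem isShift_zero (G : E → ℕ) (w : List V) : IsShift e w 0 G G := fun x => by simp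

theorem IsShift.symm (h : IsShift e w Δ G G') : IsShift e w (-Δ) G' G := fun x => by
  rw [h]
  ring

theorem exists_isShift_comm : (∃ Δ, IsShift e w Δ G G') ↔ ∃ Δ, IsShift e w Δ G' G :=
  ⟨fun ⟨_, h⟩ => ⟨_, h.symm⟩, fun ⟨_, h⟩ => ⟨_, h.symm⟩⟩

theorem IsShift.unique (hne : G ≠ G') (h : IsShift e w Δ G G') (h' : IsShift e w Δ' G G') :
    Δ = Δ' := by
  obtain ⟨x, hx⟩ := Function.ne_iff.1 hne
  have visits_ne_zero : visits e w x ≠ 0 := fun hv => hx (by simpa [hv, eq_comm] using h x)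
  exact mul_left_cancel₀ visits_ne_zero (add_left_cancel ((h x).symm.trans (h' x)))

theorem isShift_reverse (hw : Odd w.length) :
    IsShift e w.reverse Δ G G' ↔ IsShift e w (-Δ) G G' := by
  simp only [IsShift, visits_reverse hw, neg_mul, mul_neg]

theorem exists_visits_pos (hw : Odd w.length) (hne : visits e w ≠ 0) : ∃ x, 0 < visits e w x := by
  classical
  by_contra! hle
  have removed_le : removed e w ≤ removed e w.reverse := Multiset.le_iff_count.2 fun x => by
    have := hle x
    rw [visits_eq x w hw] at this
    omega
  have removed_eq : removed e w = removed e w.reverse :=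
    Multiset.eq_of_le_of_card_le removed_le (card_removed_reverse w hw).le
  refine hne (funext fun x => ?_)
  rw [visits_eq x w hw, ← removed_eq, sub_self, Pi.zero_apply]

theorem exists_visits_neg (hw : Odd w.length) (hne : visits e w ≠ 0) : ∃ x, visits e w x < 0 := by
  have hrev (x : E) : visits e w.reverse x = -visits e w x := visits_reverse hw x
  obtain ⟨x, hx⟩ := exists_visits_pos (e := e) (w := w.reverse) (by simpa using hw) fun h =>
    hne (funext fun x => by simpa [hrev] using congrFun h x)
  exact ⟨x, by simpa [hrev] using hx⟩

theorem finite_setOf_admissible (G : E → ℕ) (hw : Odd w.length) (hne : visits e w ≠ 0) :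
    {Δ | Admissible e G w Δ}.Finite := by
  obtain ⟨x, hx⟩ := exists_visits_pos hw hne
  obtain ⟨y, hy⟩ := exists_visits_neg hw hne
  refine (Set.finite_Icc (-(G x : ℤ)) (G y)).subset fun Δ hΔ => ⟨?_, ?_⟩
  · have := hΔ x
    nlinarith
  · have := hΔ y
    nlinarith

variable [Fintype V]

theorem classProb_reverse (G : E → ℕ) (w : List V) :
    classProb e F G w.reverse = classProb e F G w := by
  classical
  rw [classProb, classProb, List.reverse_reverse, Finset.pair_comm]

theorem classProb_ne_top (G : E → ℕ) (w : List V) : classProb e F G w ≠ ∞ :=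
  ENNReal.sum_ne_top.2 fun w' _ =>
    (((ENNReal.le_tsum w').trans (tsum_seqProb_le_one e F G)).trans_lt ENNReal.one_lt_top).ne

open Classical in
theorem seqProb_add_seqProb_reverse (G : E → ℕ) (w : List V) :
    seqProb e F G w + seqProb e F G w.reverse =
      (if w = w.reverse then 2 else 1) * classProb e F G w := by
  split_ifs with h
  · rw [classProb, ← h, Finset.pair_eq_singleton, Finset.sum_singleton, two_mul]
  · rw [classProb, Finset.sum_pair h, one_mul]

theorem classProb_ne_zero (hw : Closed e F G w) : classProb e F G w ≠ 0 := by
  have hle : seqProb e F G w ≤ classProb e F G w :=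
    Finset.single_le_sum (f := seqProb e F G) (fun _ _ => zero_le) (by simp)
  exact fun h => seqProb_ne_zero_iff.2 hw (le_antisymm (h ▸ hle) zero_le)

theorem IsShift.deltaWeight_eq (h : IsShift e w Δ G G') :
    deltaWeight e F G w Δ = classProb e F G' w := by
  obtain ⟨hΔ, rfl⟩ := isShift_iff.1 h
  rw [deltaWeight, if_pos hΔ]

theorem deltaWeight_congr {w' : List V}
    (h : ∀ x, (G x : ℤ) + visits e w x * Δ = G' x + visits e w' x * Δ')
    (hw : ∀ G, classProb e F G w = classProb e F G w') :
    deltaWeight e F G w Δ = deltaWeight e F G' w' Δ' := by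
  have admissible_iff : Admissible e G w Δ ↔ Admissible e G' w' Δ' := by simp only [Admissible, h]
  have shift_eq : shift e G w Δ = shift e G' w' Δ' := funext fun x => by simp only [shift, h]
  rw [deltaWeight, deltaWeight, shift_eq, hw]
  congr 1
  exact propext admissible_iff

/-- The normalizing constant of the law of `Δ`. -/
noncomputable def totalWeight (e : V → V → E) (F : Set E) (G : E → ℕ) (w : List V) : ℝ≥0∞ :=
  ∑' Δ, deltaWeight e F G w Δ

theorem IsShift.totalWeight_eq (h : IsShift e w Δ G G') :
    totalWeight e F G' w = totalWeight e F G w := by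
  rw [totalWeight, totalWeight, ← (Equiv.addLeft Δ).tsum_eq (deltaWeight e F G w)]
  refine tsum_congr fun Δ' => deltaWeight_congr (fun x => ?_) fun _ => rfl
  rw [h, Equiv.coe_addLeft]
  ring

theorem totalWeight_reverse (hw : Odd w.length) :
    totalWeight e F G w.reverse = totalWeight e F G w := by
  rw [totalWeight, totalWeight, ← (Equiv.neg ℤ).tsum_eq (deltaWeight e F G w)]
  exact tsum_congr fun Δ => deltaWeight_congr (fun x => by simp [visits_reverse hw])
    fun G => classProb_reverse G w

theorem totalWeight_ne_top (hw : Odd w.length) (hne : visits e w ≠ 0) :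
    totalWeight e F G w ≠ ∞ := by
  have hfin := finite_setOf_admissible G hw hne
  rw [totalWeight, tsum_eq_sum (s := hfin.toFinset) fun Δ hΔ => ?_]
  · refine ENNReal.sum_ne_top.2 fun Δ _ => ?_
    rw [deltaWeight]
    split_ifs
    · exact classProb_ne_top _ _
    · exact ENNReal.zero_ne_top
  · exact if_neg (by simpa using hΔ)

theorem admissible_of_deltaLaw_ne_zero (h : deltaLaw e F G w Δ ≠ 0) : Admissible e G w Δ := by
  rw [deltaLaw] at h
  split_ifs at h
  · by_contra hΔ
    simp [PMF.normalize_apply, deltaWeight, hΔ] at h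
  · obtain rfl : Δ = 0 := by
      by_contra hΔ
      simp [PMF.pure_apply, hΔ] at h
    exact (isShift_iff.1 (isShift_zero G w)).1

theorem deltaLaw_zero_ne_zero (hw : Closed e F G w) : deltaLaw e F G w 0 ≠ 0 := by
  rw [deltaLaw]
  split_ifs with h
  · rw [PMF.normalize_apply, (isShift_zero G w).deltaWeight_eq]
    exact mul_ne_zero (classProb_ne_zero hw) (ENNReal.inv_ne_zero.2 h.2)
  · simp

/-- The law of the next graph, given that the vertex sequence `w` has been sampled at `G`. -/
noncomputable def moveLaw (e : V → V → E) (F : Set E) (G : E → ℕ) (w : List V) : PMF (E → ℕ) :=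
  (deltaLaw e F G w).map (shift e G w)

theorem exists_isShift_of_moveLaw_ne_zero (h : moveLaw e F G w G' ≠ 0) :
    ∃ Δ, IsShift e w Δ G G' := by
  rw [← PMF.mem_support_iff, moveLaw, PMF.mem_support_map_iff] at h
  obtain ⟨Δ, hΔ, rfl⟩ := h
  exact ⟨Δ, isShift_iff.2 ⟨admissible_of_deltaLaw_ne_zero hΔ, rfl⟩⟩

theorem moveLaw_self_ne_zero (hw : Closed e F G w) : moveLaw e F G w G ≠ 0 := by
  rw [← PMF.mem_support_iff, moveLaw, PMF.mem_support_map_iff]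
  exact ⟨0, deltaLaw_zero_ne_zero hw, (isShift_iff.1 (isShift_zero G w)).2⟩

theorem IsShift.moveLaw_apply (hne : G ≠ G') (h : IsShift e w Δ G G') :
    moveLaw e F G w G' = classProb e F G' w * (totalWeight e F G w)⁻¹ := by
  have moveLaw_eq : moveLaw e F G w G' = deltaLaw e F G w Δ := by
    classical
    rw [moveLaw, PMF.map_apply, tsum_eq_single Δ fun Δ' hΔ' => ?_,
      if_pos (isShift_iff.1 h).2.symm]
    rw [ite_eq_right_iff]
    intro hshift
    by_contra hlaw
    exact hΔ' (IsShift.unique hne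
      (isShift_iff.2 ⟨admissible_of_deltaLaw_ne_zero hlaw, hshift.symm⟩) h)
  have hΔ : Δ ≠ 0 := by
    rintro rfl
    exact hne (funext fun x => by simpa [eq_comm] using h x)
  rw [moveLaw_eq, ← h.deltaWeight_eq, deltaLaw, totalWeight]
  split_ifs with htotal
  · rw [PMF.normalize_apply]
  · rw [PMF.pure_apply, if_neg hΔ]
    rw [not_and_or, not_not, not_not] at htotal
    rcases htotal with hzero | htop
    · rw [ENNReal.tsum_eq_zero.1 hzero, zero_mul]
    · rw [htop, ENNReal.inv_top, mul_zero]

theorem moveLaw_apply_eq_zero (h : ¬∃ Δ, IsShift e w Δ G G') : moveLaw e F G w G' = 0 :=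
  not_not.1 (mt exists_isShift_of_moveLaw_ne_zero h)

theorem classProb_mul_moveLaw_comm (hne : G ≠ G') (w : List V) :
    classProb e F G w * moveLaw e F G w G' = classProb e F G' w * moveLaw e F G' w G := by
  by_cases h : ∃ Δ, IsShift e w Δ G G'
  · obtain ⟨Δ, h⟩ := h
    rw [h.moveLaw_apply hne, h.symm.moveLaw_apply hne.symm, h.totalWeight_eq, mul_left_comm]
  · rw [moveLaw_apply_eq_zero h, moveLaw_apply_eq_zero (mt exists_isShift_comm.2 h), mul_zero,
      mul_zero]

theorem moveLaw_reverse (hne : G ≠ G') (hw : Odd w.length) :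
    moveLaw e F G w.reverse G' = moveLaw e F G w G' := by
  by_cases h : ∃ Δ, IsShift e w Δ G G'
  · obtain ⟨Δ, h⟩ := h
    have hrev : IsShift e w.reverse (-Δ) G G' := (isShift_reverse hw).2 (by rwa [neg_neg])
    rw [h.moveLaw_apply hne, hrev.moveLaw_apply hne, classProb_reverse, totalWeight_reverse hw]
  · rw [moveLaw_apply_eq_zero h,
      moveLaw_apply_eq_zero fun ⟨Δ, hΔ⟩ => h ⟨-Δ, (isShift_reverse hw).1 hΔ⟩]

theorem sampler_apply_of_ne (hne : G ≠ G') :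
    sampler e F G G' = ∑' w, seqProb e F G w * moveLaw e F G w G' := by
  rw [sampler, PMF.bind_apply, ← (Option.some_injective _).tsum_eq]
  · rfl
  · rintro (_ | w) h
    · simp [PMF.pure_apply, hne.symm] at h
    · exact ⟨w, rfl⟩

open Classical in
theorem two_mul_sampler_apply (hne : G ≠ G') :
    2 * sampler e F G G' = ∑' w : List V, (if w = w.reverse then 2 else 1) *
      (classProb e F G w * moveLaw e F G w G') := by
  have sampler_apply_reverse :
      sampler e F G G' = ∑' w, seqProb e F G w.reverse * moveLaw e F G w G' := by
    rw [sampler_apply_of_ne hne,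
      ← (List.reverse_involutive.toPerm : Equiv.Perm (List V)).tsum_eq]
    refine tsum_congr fun w => ?_
    change seqProb e F G w.reverse * moveLaw e F G w.reverse G' = _
    by_cases hw : seqProb e F G w.reverse = 0
    · rw [hw, zero_mul, zero_mul]
    · obtain ⟨_, hpath⟩ := (seqProb_ne_zero_iff.1 hw).altPath
      rw [moveLaw_reverse hne (by simpa using hpath.odd_length)]
  calc 2 * sampler e F G G'
      = ∑' w, (seqProb e F G w + seqProb e F G w.reverse) * moveLaw e F G w G' := by
        simp only [add_mul]
        rw [ENNReal.tsum_add, ← sampler_apply_of_ne hne, ← sampler_apply_reverse, two_mul]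
    _ = _ := by simp only [seqProb_add_seqProb_reverse, mul_assoc]

theorem sampler_comm (e : V → V → E) (F : Set E) (G G' : E → ℕ) :
    sampler e F G G' = sampler e F G' G := by
  rcases eq_or_ne G G' with rfl | hne
  · rfl
  · classical
    refine (ENNReal.mul_right_inj two_ne_zero ENNReal.ofNat_ne_top).1 ?_
    rw [two_mul_sampler_apply hne, two_mul_sampler_apply hne.symm]
    exact tsum_congr fun w => by rw [classProb_mul_moveLaw_comm hne]

theorem sampler_self_ne_zero (e : V → V → E) (F : Set E) (G : E → ℕ) :
    sampler e F G G ≠ 0 := by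
  rw [← PMF.mem_support_iff, sampler, PMF.mem_support_bind_iff]
  obtain ⟨o, ho⟩ := (seqLaw e F G).support_nonempty
  refine ⟨o, ho, ?_⟩
  cases o with
  | none => simp
  | some w => exact moveLaw_self_ne_zero (seqProb_ne_zero_iff.1 ho)

theorem eq_or_exists_isShift_of_sampler_ne_zero (h : sampler e F G G' ≠ 0) :
    G' = G ∨ ∃ w, Closed e F G w ∧ ∃ Δ, IsShift e w Δ G G' := by
  rw [← PMF.mem_support_iff, sampler, PMF.mem_support_bind_iff] at h
  obtain ⟨o, ho, h⟩ := h
  cases o with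
  | none => exact .inl (by simpa using h)
  | some w => exact .inr ⟨w, seqProb_ne_zero_iff.1 ho, exists_isShift_of_moveLaw_ne_zero h⟩

theorem IsShift.sampler_ne_zero (hne : G ≠ G') (h : IsShift e w Δ G G') (hw : Closed e F G w)
    (hw' : Closed e F G' w.reverse) : sampler e F G G' ≠ 0 := by
  obtain ⟨_, hpath⟩ := hw.altPath
  have visits_ne_zero : visits e w ≠ 0 := fun hv =>
    hne (funext fun x => by simpa [hv, eq_comm] using h x)
  rw [sampler_apply_of_ne hne]
  refine mt ENNReal.tsum_eq_zero.1 fun hzero => ?_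
  refine mul_ne_zero (seqProb_ne_zero_iff.2 hw) ?_ (hzero w)
  rw [h.moveLaw_apply hne, ← classProb_reverse]
  exact mul_ne_zero (classProb_ne_zero hw')
    (ENNReal.inv_ne_zero.2 (totalWeight_ne_top hpath.odd_length visits_ne_zero))

end Symmetry

/-! ## Irreducibility -/

section Irreducibility

variable {V E T : Type*} [DecidableEq E] [DecidableEq T] {e : V → V → E} {F : Set E}
  {G G' G₀ H : E → ℕ} {w₀ : V} {prev : Option V} {cur x y : V} {path w : List V} {D : E → ℤ}

/-- The strengths of a graph whose possible edges are the `e u v`, as a linear function of the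
weights. The type `T` indexes the strength sequence, and `tail u` and `head v` are the entries to
which an edge `uv` contributes: the out-strength of `u` and the in-strength of `v` for directed
graphs, the strengths of `u` and `v` for undirected graphs. -/
structure Incidence (e : V → V → E) (T : Type*) [DecidableEq T] where
  strength : (E → ℤ) →+ (T → ℤ)
  tail : V → T
  head : V → T
  exists_eq : ∀ z, ∃ u v, e u v = z
  head_injective : Function.Injective head
  strength_single : ∀ u v,
    strength (Pi.single (e u v) 1) = Pi.single (tail u) 1 + Pi.single (head v) 1
  strength_tail_nonneg : ∀ {D u}, (∀ v, 0 ≤ D (e u v)) → 0 ≤ strength D (tail u)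
  strength_head_nonneg : ∀ {D v}, (∀ u, 0 ≤ D (e u v)) → 0 ≤ strength D (head v)

namespace Incidence

variable (I : Incidence e T)

theorem exists_pos_of_strength_head_pos {v : V} (h : 0 < I.strength D (I.head v)) :
    ∃ u, 0 < D (e u v) := by
  by_contra! hD
  have : 0 ≤ I.strength (-D) (I.head v) := I.strength_head_nonneg fun u => by simpa using hD u
  rw [map_neg, Pi.neg_apply] at this
  omega

theorem exists_neg_of_pos {u v v' : V} (hpos : 0 < D (e u v))
    (h : I.strength D = Pi.single (I.head v) 1 - Pi.single (I.head v') 1) :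
    ∃ y, D (e u y) < 0 := by
  by_contra! hD
  have nonneg : 0 ≤ I.strength (D - Pi.single (e u v) 1) (I.tail u) := by
    refine I.strength_tail_nonneg fun y => ?_
    have := hD y
    rw [Pi.sub_apply, Pi.single_apply]
    split_ifs with hy
    · rw [hy]
      omega
    · omega
  have head_nonneg : 0 ≤ (Pi.single (I.head v') 1 : T → ℤ) (I.tail u) :=
    (Pi.single_nonneg.2 zero_le_one : (0 : T → ℤ) ≤ _) _
  simp only [map_sub, h, I.strength_single, Pi.sub_apply, Pi.add_apply, Pi.single_eq_same] at nonneg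
  omega

theorem exists_pos_of_neg {u v : V} (hneg : D (e u v) < 0) (h : I.strength D = 0) :
    ∃ u', 0 < D (e u' v) := by
  by_contra! hD
  have nonneg : 0 ≤ I.strength (-D - Pi.single (e u v) 1) (I.head v) := by
    refine I.strength_head_nonneg fun u' => ?_
    have := hD u'
    rw [Pi.sub_apply, Pi.neg_apply, Pi.single_apply]
    split_ifs with hu'
    · rw [hu']
      omega
    · omega
  have tail_nonneg : 0 ≤ (Pi.single (I.tail u) 1 : T → ℤ) (I.head v) :=
    (Pi.single_nonneg.2 zero_le_one : (0 : T → ℤ) ≤ _) _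
  simp only [map_sub, map_neg, h, I.strength_single, Pi.sub_apply, Pi.add_apply, Pi.neg_apply,
    Pi.zero_apply, Pi.single_eq_same] at nonneg
  omega

theorem strength_visits {a c : V} (h : AltPath e F a c w) :
    I.strength (visits e w) = Pi.single (I.head a) 1 - Pi.single (I.head c) 1 := by
  induction h with
  | singleton => rw [sub_self, ← map_zero I.strength]; rfl
  | step h hx hy ih =>
    rw [h.visits_append hx hy, map_sub, map_add, ih, I.strength_single, I.strength_single]
    abel

/-- The graphs with the strengths of `G₀` and the weights of `G₀` on `F`. -/
def graphs (G₀ : E → ℕ) (F : Set E) : Set (E → ℕ) :=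
  {G | I.strength (fun z => (G z : ℤ) - G₀ z) = 0 ∧ ∀ z ∈ F, G z = G₀ z}

variable {I}

theorem mem_graphs_of_mem_of_mem (hG : G ∈ I.graphs G₀ F) (hH : H ∈ I.graphs G₀ F) :
    G ∈ I.graphs H F := by
  refine ⟨?_, fun z hz => (hG.2 z hz).trans (hH.2 z hz).symm⟩
  have sub_eq : (fun z => (G z : ℤ) - H z) =
      (fun z => (G z : ℤ) - G₀ z) - fun z => (H z : ℤ) - G₀ z := by
    ext z
    simp only [Pi.sub_apply, sub_sub_sub_cancel_right]
  rw [sub_eq, map_sub, hG.1, hH.1, sub_zero]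

theorem mem_graphs_of_isShift {Δ : ℤ} (hG : G ∈ I.graphs G₀ F) (hw : Closed e F H w)
    (h : IsShift e w Δ G G') : G' ∈ I.graphs G₀ F := by
  obtain ⟨_, hpath⟩ := hw.altPath
  refine ⟨?_, fun z hz => ?_⟩
  · have sub_eq : (fun z => (G' z : ℤ) - G₀ z) =
        (fun z => (G z : ℤ) - G₀ z) + Δ • visits e w := by
      ext z
      simp only [h z, Pi.add_apply, Pi.smul_apply, smul_eq_mul]
      ring
    rw [sub_eq, map_add, map_zsmul, hG.1, I.strength_visits hpath, sub_self, smul_zero, add_zero]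
  · have hz' := h z
    rw [hpath.visits_eq_zero hz, zero_mul, add_zero, hG.2 z hz] at hz'
    exact_mod_cast hz'

theorem support_sampler_subset [Fintype V] (hG : G ∈ I.graphs G₀ F) :
    (sampler e F G).support ⊆ I.graphs G₀ F := by
  intro G' hG'
  rcases eq_or_exists_isShift_of_sampler_ne_zero hG' with rfl | ⟨w, hw, Δ, h⟩
  · exact hG
  · exact mem_graphs_of_isShift hG hw h

end Incidence

/-- A running sampling loop at `G` that only removes edges where `G` exceeds `H` and only adds edges
where `H` exceeds `G`, and neither more often than needed to turn `G` into `H`. The subtractions are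
truncated, so that an edge cannot be both removed and added. -/
structure Trail (e : V → V → E) (F : Set E) (G H : E → ℕ) (w₀ : V) (prev : Option V) (cur : V)
    (path : List V) : Prop where
  run : Run e F G w₀ prev cur path
  count_removed_le : ∀ z, (removed e path).count z ≤ G z - H z
  count_added_le : ∀ z, (removed e path.reverse).count z ≤ H z - G z

/-- What is left of the difference of `G` and `H` after the move along `path` with `Δ = -1`. -/
noncomputable def residual (e : V → V → E) (G H : E → ℕ) (path : List V) (z : E) : ℤ :=
  G z - H z - visits e path z

namespace Trail

theorem residual_eq (h : Trail e F G H w₀ prev cur path) (z : E) :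
    residual e G H path z =
      G z - H z - ((removed e path).count z - (removed e path.reverse).count z) := by
  rw [residual, visits_eq z path h.run.altPath.odd_length]

theorem count_removed_lt (h : Trail e F G H w₀ prev cur path) {z : E}
    (hz : 0 < residual e G H path z) : (removed e path).count z < G z - H z := by
  have := h.count_removed_le z
  have := h.count_added_le z
  rw [h.residual_eq] at hz
  omega

theorem count_added_lt (h : Trail e F G H w₀ prev cur path) {z : E}
    (hz : residual e G H path z < 0) : (removed e path.reverse).count z < H z - G z := by
  have := h.count_removed_le z
  have := h.count_added_le z
  rw [h.residual_eq] at hz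
  omega

theorem count_removed_append_le (h : Trail e F G H w₀ prev cur path)
    (hx : 0 < residual e G H path (e x cur)) (y : V) (z : E) :
    (removed e (path ++ [x, y])).count z ≤ G z - H z := by
  have := h.count_removed_le z
  have := h.count_removed_lt hx
  rw [h.run.altPath.removed_append, Multiset.count_cons]
  split_ifs with hz
  · subst hz
    omega
  · omega

theorem canRemove (hF : ∀ z ∈ F, G z = H z) (h : Trail e F G H w₀ prev cur path)
    (hx : 0 < residual e G H path (e x cur)) : CanRemove e F G prev cur x := by
  have hlt := h.count_removed_lt hx
  refine ⟨⟨by omega, fun hxF => ?_⟩, ?_⟩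
  · rw [hF _ hxF] at hlt
    omega
  · rintro rfl
    have := h.count_added_le (e x cur)
    have := Multiset.count_pos.2 h.run.mem_removed_reverse
    omega

theorem start (hF : ∀ z ∈ F, G z = H z) (hx : H (e x w₀) < G (e x w₀)) :
    Trail e F G H w₀ none w₀ [w₀] where
  run := .start (x := x) ⟨⟨by omega, fun hxF => hx.ne (hF _ hxF).symm⟩, nofun⟩
  count_removed_le := by simp [removed]
  count_added_le := by simp [removed]

theorem step (hF : ∀ z ∈ F, G z = H z) (h : Trail e F G H w₀ prev cur path)
    (hx : 0 < residual e G H path (e x cur)) (hw₀ : ¬CanAdd e F cur x w₀)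
    (hy : residual e G H path (e x y) < 0) :
    Trail e F G H w₀ (some x) y (path ++ [x, y]) := by
  have hy' := h.count_added_lt hy
  have canAdd : CanAdd e F cur x y := by
    refine ⟨?_, fun hyF => ?_⟩
    · rintro rfl
      exact hx.not_gt hy
    · rw [hF _ hyF] at hy'
      omega
  refine ⟨h.run.step (h.canRemove hF hx) hw₀ canAdd,
    h.count_removed_append_le hx y, fun z => ?_⟩
  have := h.count_added_le z
  rw [h.run.altPath.removed_reverse_append, Multiset.count_cons]
  split_ifs with hz
  · subst hz
    omega
  · omega

variable {I : Incidence e T}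

theorem strength_residual (hGH : G ∈ I.graphs H F) (h : Trail e F G H w₀ prev cur path) :
    I.strength (residual e G H path) = Pi.single (I.head cur) 1 - Pi.single (I.head w₀) 1 := by
  have residual_eq_sub : residual e G H path = (fun z => (G z : ℤ) - H z) - visits e path := rfl
  rw [residual_eq_sub, map_sub, hGH.1, I.strength_visits h.run.altPath, zero_sub, neg_sub]

theorem exists_residual_pos (hGH : G ∈ I.graphs H F) (h : Trail e F G H w₀ prev cur path)
    (hcur : cur ≠ w₀) : ∃ x, 0 < residual e G H path (e x cur) := by
  refine I.exists_pos_of_strength_head_pos ?_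
  rw [h.strength_residual hGH, Pi.sub_apply, Pi.single_eq_same,
    Pi.single_eq_of_ne (I.head_injective.ne hcur)]
  norm_num

theorem exists_step (hGH : G ∈ I.graphs H F) (h : Trail e F G H w₀ prev cur path)
    (hx : 0 < residual e G H path (e x cur)) (hw₀ : ¬CanAdd e F cur x w₀) :
    ∃ y, y ≠ w₀ ∧ Trail e F G H w₀ (some x) y (path ++ [x, y]) := by
  obtain ⟨y, hy⟩ := I.exists_neg_of_pos hx (h.strength_residual hGH)
  have hstep := h.step hGH.2 hx hw₀ hy
  refine ⟨y, ?_, hstep⟩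
  rintro rfl
  simpa using congrArg List.length hstep.run.eq_singleton

theorem card_added_le [Fintype E] (h : Trail e F G H w₀ prev cur path) :
    (removed e path.reverse).card ≤ ∑ z, (H z - G z) := by
  rw [← Multiset.sum_count_eq_card fun z _ => Finset.mem_univ z]
  exact Finset.sum_le_sum fun z _ => h.count_added_le z

theorem exists_canAdd [Finite E] (hGH : G ∈ I.graphs H F) (h : Trail e F G H w₀ prev cur path)
    (hx : 0 < residual e G H path (e x cur)) :
    ∃ prev cur path x, Trail e F G H w₀ prev cur path ∧ 0 < residual e G H path (e x cur) ∧
      CanAdd e F cur x w₀ := by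
  cases nonempty_fintype E
  induction hn : (∑ z, (H z - G z)) - (removed e path.reverse).card using Nat.strong_induction_on
    generalizing prev cur path x with
  | _ n ih =>
    by_cases hw₀ : CanAdd e F cur x w₀
    · exact ⟨prev, cur, path, x, h, hx, hw₀⟩
    · obtain ⟨y, hy, hstep⟩ := h.exists_step hGH hx hw₀
      obtain ⟨x', hx'⟩ := hstep.exists_residual_pos hGH hy
      refine ih _ ?_ hstep hx' rfl
      have := hstep.card_added_le
      rw [h.run.altPath.removed_reverse_append, Multiset.card_cons] at this ⊢
      omega

end Trail

theorem exists_trail [Finite E] {I : Incidence e T} (hGH : G ∈ I.graphs H F) (hne : G ≠ H) :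
    ∃ w₀ prev cur path x, Trail e F G H w₀ prev cur path ∧
      0 < residual e G H path (e x cur) ∧ CanAdd e F cur x w₀ := by
  obtain ⟨w₀, x, hx⟩ : ∃ w₀ x, 0 < (G (e x w₀) : ℤ) - H (e x w₀) := by
    obtain ⟨z, hz⟩ := Function.ne_iff.1 hne
    obtain ⟨u, v, rfl⟩ := I.exists_eq z
    rcases lt_or_gt_of_ne hz with hlt | hgt
    · exact ⟨v, I.exists_pos_of_neg (D := fun z => G z - H z) (u := u) (by omega) hGH.1⟩
    · exact ⟨v, u, by omega⟩
  exact ⟨w₀, (Trail.start hGH.2 (x := x) (by omega)).exists_canAdd hGH (x := x)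
    (by simpa [residual, visits] using hx)⟩

theorem exists_isShift_neg_one (hw : Odd w.length)
    (hle : ∀ z, (removed e w).count z ≤ G z) :
    ∃ G', IsShift e w (-1) G G' ∧ ∀ z ∈ removed e w.reverse, 0 < G' z := by
  refine ⟨fun z => G z - (removed e w).count z + (removed e w.reverse).count z, fun z => ?_,
    fun z hz => Nat.add_pos_right _ (Multiset.count_pos.2 hz)⟩
  have := hle z
  rw [visits_eq z w hw]
  push_cast [this]
  ring

/-- The distance of the weight functions in `ℓ¹`. -/
def weightDist [Fintype E] (G H : E → ℕ) : ℕ := ∑ z, ((G z : ℤ) - H z).natAbs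

theorem Trail.weightDist_lt [Fintype E] (h : Trail e F G H w₀ prev cur path)
    (hx : 0 < residual e G H path (e x cur)) (hcur : w₀ ≠ cur)
    (hG' : IsShift e (path ++ [x, w₀]) (-1) G G') : weightDist G' H < weightDist G H := by
  have hodd : Odd (path ++ [x, w₀]).length := by
    simpa [parity_simps] using h.run.altPath.odd_length
  have natAbs_add_le (z : E) :
      ((G' z : ℤ) - H z).natAbs + (removed e (path ++ [x, w₀])).count z ≤
        ((G z : ℤ) - H z).natAbs + if z = e x w₀ then 1 else 0 := by
    have := h.count_removed_append_le hx w₀ z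
    have := h.count_added_le z
    rw [hG' z, visits_eq z _ hodd, h.run.altPath.removed_reverse_append, Multiset.count_cons]
    split_ifs <;> omega
  have two_le_card : 2 ≤ (removed e (path ++ [x, w₀])).card := by
    have := Multiset.card_pos.2 (h.run.removed_ne_zero hcur.symm)
    rw [h.run.altPath.removed_append, Multiset.card_cons]
    omega
  have dist_add_card_le := Finset.sum_le_sum fun z (_ : z ∈ Finset.univ) => natAbs_add_le z
  rw [Finset.sum_add_distrib, Finset.sum_add_distrib, Finset.sum_ite_eq' Finset.univ,
    if_pos (Finset.mem_univ _), Multiset.sum_count_eq_card fun z _ => Finset.mem_univ z]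
    at dist_add_card_le
  rw [weightDist, weightDist]
  omega

theorem Incidence.exists_closer [Fintype V] [Fintype E] {I : Incidence e T}
    (hGH : G ∈ I.graphs H F) (hne : G ≠ H) :
    ∃ G' ∈ I.graphs H F, sampler e F G G' ≠ 0 ∧ weightDist G' H < weightDist G H := by
  obtain ⟨w₀, prev, cur, path, x, h, hx, hw₀⟩ := exists_trail hGH hne
  have hclosed : Closed e F G (path ++ [x, w₀]) := .close h.run (h.canRemove hGH.2 hx) hw₀
  obtain ⟨_, hpath⟩ := hclosed.altPath
  obtain ⟨G', hshift, hpos⟩ := exists_isShift_neg_one hpath.odd_length fun z =>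
    (h.count_removed_append_le hx w₀ z).trans (Nat.sub_le _ _)
  have hlt := h.weightDist_lt hx hw₀.1 hshift
  refine ⟨G', mem_graphs_of_isShift hGH hclosed hshift,
    hshift.sampler_ne_zero ?_ hclosed (hclosed.reverse hpos), hlt⟩
  rintro rfl
  exact lt_irrefl _ hlt

theorem Incidence.exists_nStep_sampler_ne_zero [Fintype V] {I : Incidence e T}
    (hGH : G ∈ I.graphs H F) : ∃ n, nStep (sampler e F) n G H ≠ 0 := by
  have : Finite E := .of_surjective (fun p : V × V => e p.1 p.2) fun z =>
    let ⟨u, v, h⟩ := I.exists_eq z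
    ⟨(u, v), h⟩
  cases nonempty_fintype E
  induction hn : weightDist G H using Nat.strong_induction_on generalizing G with
  | _ n ih =>
    rcases eq_or_ne G H with rfl | hne
    · exact ⟨0, by simp [nStep]⟩
    · obtain ⟨G', hG', hpos, hlt⟩ := I.exists_closer hGH hne
      obtain ⟨m, hm⟩ := ih _ (hn ▸ hlt) hG' rfl
      exact ⟨1 + m, nStep_add_ne_zero (by rwa [nStep_one]) hm⟩

theorem Incidence.isReversible_and_isErgodicOn [Fintype V] (I : Incidence e T)
    {S : Set (E → ℕ)} (hS : S = I.graphs G₀ F) (hfin : S.Finite) (hne : hfin.toFinset.Nonempty) :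
    IsReversible (sampler e F) (PMF.uniformOfFinset hfin.toFinset hne) ∧
      IsErgodicOn (sampler e F) S (PMF.uniformOfFinset hfin.toFinset hne) := by
  have stays : ∀ G ∈ hfin.toFinset, (sampler e F G).support ⊆ hfin.toFinset := fun G hG => by
    rw [hfin.mem_toFinset, hS] at hG
    rw [hfin.coe_toFinset, hS]
    exact support_sampler_subset hG
  have reversible := isReversible_uniformOfFinset hne stays (sampler_comm e F)
  have irreducible : ∀ G ∈ hfin.toFinset, ∀ H ∈ hfin.toFinset,
      ∃ n, nStep (sampler e F) n G H ≠ 0 := fun G hG H hH => by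
    rw [hfin.mem_toFinset, hS] at hG hH
    exact exists_nStep_sampler_ne_zero (mem_graphs_of_mem_of_mem hG hH)
  have ergodic := isErgodicOn_of_loop stays (by simp) reversible.bind_eq
    (fun G _ => sampler_self_ne_zero e F G) irreducible
  exact ⟨reversible, by rwa [hfin.coe_toFinset] at ergodic⟩

end Irreducibility

/-! ## Directed and undirected graphs -/

section Instances

variable (V : Type*) [Fintype V] [DecidableEq V]

/-- The strength sequence of a directed graph: the out-strengths are indexed by `Sum.inl`, the
in-strengths by `Sum.inr`. -/
def directedIncidence : Incidence (Prod.mk : V → V → V × V) (V ⊕ V) where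
  strength :=
    { toFun := fun D => Sum.elim (fun u => ∑ v, D (u, v)) fun v => ∑ u, D (u, v)
      map_zero' := by ext (u | u) <;> simp
      map_add' := fun D D' => by ext (u | u) <;> simp [Finset.sum_add_distrib] }
  tail := .inl
  head := .inr
  exists_eq z := ⟨z.1, z.2, rfl⟩
  head_injective := Sum.inr_injective
  strength_single u v := by
    ext (t | t)
    · by_cases hu : t = u <;> simp [Pi.single_apply, hu, -Finset.sum_boole]
    · by_cases hv : t = v <;> simp [Pi.single_apply, hv, -Finset.sum_boole]
  strength_tail_nonneg h := Finset.sum_nonneg fun v _ => h v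
  strength_head_nonneg h := Finset.sum_nonneg fun u _ => h u

/-- The strength sequence of an undirected graph. -/
def undirectedIncidence : Incidence (fun u v : V => s(u, v)) V where
  strength :=
    { toFun := fun D u => (∑ v, D s(u, v)) + D s(u, u)
      map_zero' := by ext; simp
      map_add' := fun D D' => by
        ext
        simp only [Pi.add_apply, Finset.sum_add_distrib]
        ring }
  tail := id
  head := id
  exists_eq := Sym2.ind fun u v => ⟨u, v, rfl⟩
  head_injective := Function.injective_id
  strength_single u v := by
    ext t
    simp only [AddMonoidHom.coe_mk, ZeroHom.coe_mk, id_eq, Pi.add_apply, Pi.single_apply]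
    rcases eq_or_ne t u with rfl | hu
    · simp only [Sym2.congr_right, Finset.sum_ite_eq', Finset.mem_univ, if_true]
    · rcases eq_or_ne t v with rfl | hv
      · simp only [Sym2.eq_swap (a := u), Sym2.congr_right, Finset.sum_ite_eq', Finset.mem_univ,
          if_true, add_comm]
      · simp [hu, hv]
  strength_tail_nonneg h := add_nonneg (Finset.sum_nonneg fun v _ => h v) (h _)
  strength_head_nonneg h :=
    add_nonneg (Finset.sum_nonneg fun u _ => Sym2.eq_swap ▸ h u) (h _)

variable {V}

theorem directedGraphs_eq (G₀ : V × V → ℕ) (F : Set (V × V)) :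
    directedGraphs G₀ F = (directedIncidence V).graphs G₀ F := by
  ext G
  have strength_eq_zero_iff : (directedIncidence V).strength (fun z => (G z : ℤ) - G₀ z) = 0 ↔
      (∀ u, outStrength G u = outStrength G₀ u) ∧ ∀ u, inStrength G u = inStrength G₀ u := by
    simp only [directedIncidence, AddMonoidHom.coe_mk, ZeroHom.coe_mk, funext_iff, Sum.forall,
      Sum.elim_inl, Sum.elim_inr, Finset.sum_sub_distrib, Pi.zero_apply, sub_eq_zero, outStrength,
      inStrength]
    norm_cast
  simp only [directedGraphs, Incidence.graphs, Set.mem_ofPred_eq, strength_eq_zero_iff, and_assoc]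

theorem undirectedGraphs_eq (G₀ : Sym2 V → ℕ) (F : Set (Sym2 V)) :
    undirectedGraphs G₀ F = (undirectedIncidence V).graphs G₀ F := by
  ext G
  have strength_eq_zero_iff : (undirectedIncidence V).strength (fun z => (G z : ℤ) - G₀ z) = 0 ↔
      ∀ u, strength G u = strength G₀ u := by
    simp only [undirectedIncidence, AddMonoidHom.coe_mk, ZeroHom.coe_mk, funext_iff,
      Finset.sum_sub_distrib, Pi.zero_apply, ← add_sub_add_comm, sub_eq_zero, strength]
    norm_cast
  simp only [undirectedGraphs, Incidence.graphs, Set.mem_ofPred_eq, strength_eq_zero_iff]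

end Instances

end WGS

theorem proposition4 {V : Type*} [Fintype V] :
    (∀ (G₀ : V × V → ℕ) (F : Set (V × V)),
      WGS.IsReversible (WGS.sampler Prod.mk F) (WGS.directedUniform G₀ F) ∧
      WGS.IsErgodicOn (WGS.sampler Prod.mk F) (WGS.directedGraphs G₀ F)
        (WGS.directedUniform G₀ F)) ∧
    (∀ (G₀ : Sym2 V → ℕ) (F : Set (Sym2 V)),
      WGS.IsReversible (WGS.sampler (fun u v => s(u, v)) F) (WGS.undirectedUniform G₀ F) ∧
      WGS.IsErgodicOn (WGS.sampler (fun u v => s(u, v)) F) (WGS.undirectedGraphs G₀ F)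
        (WGS.undirectedUniform G₀ F)) := by
  classical
  exact ⟨fun G₀ F => (WGS.directedIncidence V).isReversible_and_isErgodicOn
      (WGS.directedGraphs_eq G₀ F) (WGS.finite_directedGraphs G₀ F) _,
    fun G₀ F => (WGS.undirectedIncidence V).isReversible_and_isErgodicOn
      (WGS.undirectedGraphs_eq G₀ F) (WGS.finite_undirectedGraphs G₀ F) _⟩
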